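/- Let $d\ge 1$ be an integer and let $A=\mathbb Z^d$ or $A=\mathbb Z_+^d$ (where $\mathbb Z_+$ may be read as $\{0,1,2,\dots\}$ or as $\{1,2,3,\dots\}$). Let $\mathcal H$ be a complex Hilbert space with an orthonormal basis $(\varphi_n)_{n\in A}$ (so $\mathcal H$ is separable), let $U:\mathcal H\to\mathcal H$ be unitary, let $\psi\in\mathcal H$ with $\|\psi\|=1$, and let $p>0$ be real. Dynamical quantities. For $n\in A$ write $|n|=|n_1|+\dots+|n_d|$, and for integers $k\ge 0$, $K\ge 1$ put $$a_\psi(n,k)=|\langle\varphi_n,U^k\psi\rangle|^2,\qquad |X|^p_\psi(k)=\sum_{n\in A}(|n|^p+1)\,a_\psi(n,k)\in[1,\infty],\qquad \langle|X|^p_\psi\rangle(K)=\frac1K\sum_{k=0}^{K-1}|X|^p_\psi(k).$$ The lower time-averaged transport exponent is $$\tilde\beta^-_\psi(p)=\liminf_{K\to\infty}\frac{\log\big(\langle|X|^p_\psi\rangle(K)\big)}{p\log K}\in[0,\infty],\qquad \log\infty=\infty .$$ Spectral quantities. For $\phi\in\mathcal H$, the spectral measure $\mu_\phi=\mu_\phi^U$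 is the finite Borel measure on the unit circle $\partial\mathbb D=\{z\in\mathbb C:|z|=1\}$ determined by $\langle\phi,f(U)\phi\rangle=\int f\,d\mu_\phi$ for all continuous $f:\partial\mathbb D\to\mathbb C$. The upper Hausdorff dimension of a finite Borel measure $\mu$ on $\partial\mathbb D$ is $$\dim_{\mathrm H}^+(\mu)=\inf\{\dim_{\mathrm H}(S): S\subseteq\partial\mathbb D\text{ measurable},\ \mu(S)=\mu(\partial\mathbb D)\}.$$ For $\alpha\ge 0$, a measure $\mu$ on $\partial\mathbb D$ is called $\alpha$-continuous if $\mu(E)=0$ for every $E\subseteq\partial\mathbb D$ whose $\alpha$-dimensional Hausdorff measure is $0$. Let $P_{\alpha c}$ be the orthogonal projection onto the closed subspace $\mathcal H_{\alpha c}=\{\phi\in\mathcal H:\mu_\phi\text{ is }\alpha\text{-continuous}\}$. Then $$\tilde\beta^-_\psi(p)\ \ge\ \frac{\dim_{\mathrm H}^+(\mu_\psi)}{d},$$ and, for every $\alpha\in[0,1]$ with $P_{\alpha c}\psi\ne 0$, $$\tilde\beta^-_\psi(p)\ \ge\ \frac{\alpha}{d}.$$ -/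

import Mathlib

open MeasureTheory Filter
open scoped ENNReal NNReal InnerProductSpace CompactlySupported

namespace UnitaryTransport

/-- The unit circle `{z ∈ ℂ : |z| = 1}`, with the metric, topology and Borel structure of `ℂ`. -/
abbrev UnitCircle : Set ℂ := Metric.sphere (0 : ℂ) 1

noncomputable section

section SpectralMeasure

variable {H : Type*} [NormedAddCommGroup H] [InnerProductSpace ℂ H] [CompleteSpace H]

/-- The continuous functional calculus `f ↦ f(U)` of a unitary operator `U`, for continuous
functions `f` on the unit circle (which contains the spectrum of `U`). -/
def funCalc (U : unitary (H →L[ℂ] H)) : C(UnitCircle, ℂ) →⋆ₐ[ℂ] (H →L[ℂ] H) :=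
  cfcHomSuperset (a := (U : H →L[ℂ] H)) (p := IsStarNormal) inferInstance
    (Unitary.spectrum_subset_circle U)

lemma funCalc_id (U : unitary (H →L[ℂ] H)) :
    funCalc U ⟨fun z => (z : ℂ), continuous_subtype_val⟩ = (U : H →L[ℂ] H) :=
  cfcHomSuperset_id (a := (U : H →L[ℂ] H)) (p := IsStarNormal) inferInstance
    (Unitary.spectrum_subset_circle U)

/-- A real continuous function on the circle, seen as a complex one. -/
def toComplex (f : UnitCircle → ℝ) (hf : Continuous f) : C(UnitCircle, ℂ) :=
  ⟨fun z => (f z : ℂ), Complex.continuous_ofReal.comp hf⟩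

lemma inner_funCalc_nonneg (U : unitary (H →L[ℂ] H)) (ψ : H) (f : UnitCircle → ℝ)
    (hf : Continuous f) (h0 : ∀ z, 0 ≤ f z) :
    0 ≤ (⟪ψ, funCalc U (toComplex f hf) ψ⟫_ℂ).re := by
  set g : C(UnitCircle, ℂ) := toComplex (fun z => Real.sqrt (f z)) hf.sqrt with hg
  have h1 : toComplex f hf = star g * g := by
    ext z
    simp only [toComplex, hg, ContinuousMap.coe_mk, ContinuousMap.mul_apply,
      ContinuousMap.star_apply, RCLike.star_def, Complex.conj_ofReal, ← Complex.ofReal_mul,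
      Real.mul_self_sqrt (h0 z)]
  rw [h1, map_mul, map_star, mul_apply_eq_comp, ContinuousLinearMap.star_eq_adjoint,
    ContinuousLinearMap.adjoint_inner_right]
  exact inner_self_nonneg (𝕜 := ℂ)

/-- The positive linear functional `f ↦ ⟨ψ, f(U) ψ⟩` on real continuous functions on the circle
(all of them compactly supported, the circle being compact). -/
def spectralFunctional (U : unitary (H →L[ℂ] H)) (ψ : H) : C_c(UnitCircle, ℝ) →ₚ[ℝ] ℝ :=
  PositiveLinearMap.mk₀
    { toFun := fun f => (⟪ψ, funCalc U (toComplex f f.continuous) ψ⟫_ℂ).re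
      map_add' := fun f g => by
        have : toComplex (f + g : C_c(UnitCircle, ℝ)) (f + g).continuous
            = toComplex f f.continuous + toComplex g g.continuous := by
          ext z; simp [toComplex]
        rw [this, map_add, add_apply, inner_add_right, Complex.add_re]
      map_smul' := fun c f => by
        have : toComplex (c • f : C_c(UnitCircle, ℝ)) (c • f).continuous
            = (c : ℂ) • toComplex f f.continuous := by
          ext z; simp [toComplex]
        rw [this, map_smul, smul_apply, inner_smul_right,
          Complex.re_ofReal_mul]
        rfl }
    (fun f hf => inner_funCalc_nonneg U ψ f f.continuous hf)

/-- The spectral measure of the unitary operator `U` and the vector `ψ`: the Borel measure on the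
circle that represents the functional `f ↦ ⟨ψ, f(U) ψ⟩` (Riesz–Markov–Kakutani). -/
def spectralMeasure (U : unitary (H →L[ℂ] H)) (ψ : H) : Measure UnitCircle :=
  RealRMK.rieszMeasure (spectralFunctional U ψ)

instance (U : unitary (H →L[ℂ] H)) (ψ : H) : IsFiniteMeasure (spectralMeasure U ψ) := by
  unfold spectralMeasure; infer_instance

lemma integral_spectralMeasure_real (U : unitary (H →L[ℂ] H)) (ψ : H) (f : UnitCircle → ℝ)
    (hf : Continuous f) :
    ∫ z, f z ∂(spectralMeasure U ψ) = (⟪ψ, funCalc U (toComplex f hf) ψ⟫_ℂ).re :=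
  RealRMK.integral_rieszMeasure (spectralFunctional U ψ)
    (CompactlySupportedContinuousMap.continuousMapEquiv ⟨f, hf⟩)

lemma inner_funCalc_im (U : unitary (H →L[ℂ] H)) (ψ : H) (f : UnitCircle → ℝ)
    (hf : Continuous f) : (⟪ψ, funCalc U (toComplex f hf) ψ⟫_ℂ).im = 0 := by
  have h1 : star (toComplex f hf) = toComplex f hf := by
    ext z; simp [toComplex]
  rw [← Complex.conj_eq_iff_im, inner_conj_symm]
  conv_lhs => rw [← h1, map_star, ContinuousLinearMap.star_eq_adjoint,
    ContinuousLinearMap.adjoint_inner_left]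

/-- The defining property of the spectral measure: `⟨ψ, f(U) ψ⟩ = ∫ f dμ`. -/
theorem inner_funCalc_eq_integral (U : unitary (H →L[ℂ] H)) (ψ : H) (f : C(UnitCircle, ℂ)) :
    ⟪ψ, funCalc U f ψ⟫_ℂ = ∫ z, f z ∂(spectralMeasure U ψ) := by
  have hre : Continuous fun z => (f z).re := Complex.continuous_re.comp f.continuous
  have him : Continuous fun z => (f z).im := Complex.continuous_im.comp f.continuous
  have hf : f = toComplex _ hre + Complex.I • toComplex _ him := by
    ext z
    simp [toComplex, mul_comm Complex.I]
  have hint : Integrable (fun z => f z) (spectralMeasure U ψ) :=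
    f.continuous.integrable_of_hasCompactSupport (HasCompactSupport.of_compactSpace _)
  have e : ∀ (g : UnitCircle → ℝ) (hg : Continuous g), ⟪ψ, funCalc U (toComplex g hg) ψ⟫_ℂ
      = ((∫ z, g z ∂(spectralMeasure U ψ) : ℝ) : ℂ) := by
    intro g hg
    apply Complex.ext
    · rw [integral_spectralMeasure_real U ψ g hg, Complex.ofReal_re]
    · rw [inner_funCalc_im, Complex.ofReal_im]
  have h2 : ∫ z, f z ∂(spectralMeasure U ψ)
      = ((∫ z, (f z).re ∂(spectralMeasure U ψ) : ℝ) : ℂ)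
        + ((∫ z, (f z).im ∂(spectralMeasure U ψ) : ℝ) : ℂ) * Complex.I :=
    (integral_re_add_im hint).symm
  rw [h2]
  conv_lhs => rw [hf]
  rw [map_add, map_smul, add_apply, smul_apply,
    inner_add_right, inner_smul_right, e, e, mul_comm]

/-- The spectral measure is the only finite Borel measure with this property. -/
theorem eq_spectralMeasure (U : unitary (H →L[ℂ] H)) (ψ : H) (ν : Measure UnitCircle)
    [IsFiniteMeasure ν] (h : ∀ (f : UnitCircle → ℝ) (hf : Continuous f),
      ∫ z, f z ∂ν = (⟪ψ, funCalc U (toComplex f hf) ψ⟫_ℂ).re) :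
    ν = spectralMeasure U ψ :=
  ext_of_forall_integral_eq_of_IsFiniteMeasure fun f => by
    rw [h f f.continuous, integral_spectralMeasure_real U ψ f f.continuous]

lemma spectralMeasure_univ (U : unitary (H →L[ℂ] H)) (ψ : H) :
    spectralMeasure U ψ Set.univ = ENNReal.ofReal (‖ψ‖ ^ 2) := by
  have h := integral_spectralMeasure_real U ψ (fun _ => 1) continuous_const
  have h1 : toComplex (fun _ => 1) continuous_const = 1 := by ext z; simp [toComplex]
  have h3 : (⟪ψ, ψ⟫_ℂ).re = ‖ψ‖ ^ 2 := inner_self_eq_norm_sq (𝕜 := ℂ) ψ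
  rw [h1, map_one, one_apply_eq_self, h3, integral_const, smul_eq_mul, mul_one] at h
  rw [← h, ofReal_measureReal]

lemma spectralMeasure_smul (U : unitary (H →L[ℂ] H)) (c : ℂ) (ψ : H) :
    spectralMeasure U (c • ψ) = ((‖c‖₊ ^ 2 : ℝ≥0)) • spectralMeasure U ψ := by
  symm
  apply eq_spectralMeasure
  intro f hf
  rw [integral_smul_nnreal_measure, integral_spectralMeasure_real U ψ f hf, map_smul,
    inner_smul_left, inner_smul_right, ← mul_assoc, ← Complex.normSq_eq_conj_mul_self,
    Complex.re_ofReal_mul, Complex.normSq_eq_norm_sq, NNReal.smul_def]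
  simp

lemma spectralMeasure_parallelogram (U : unitary (H →L[ℂ] H)) (φ ψ : H) :
    spectralMeasure U (φ + ψ) + spectralMeasure U (φ - ψ)
      = (2 : ℝ≥0) • spectralMeasure U φ + (2 : ℝ≥0) • spectralMeasure U ψ := by
  apply ext_of_forall_integral_eq_of_IsFiniteMeasure
  intro f
  have hi : ∀ (ν : Measure UnitCircle) [IsFiniteMeasure ν], Integrable (fun z => f z) ν :=
    fun ν _ => f.integrable ν
  rw [integral_add_measure (hi _) (hi _), integral_add_measure (hi _) (hi _),
    integral_smul_nnreal_measure, integral_smul_nnreal_measure]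
  simp only [integral_spectralMeasure_real U _ f f.continuous, map_add, map_sub, inner_add_left,
    inner_add_right, inner_sub_left, inner_sub_right, Complex.add_re, Complex.sub_re,
    NNReal.smul_def, smul_eq_mul, NNReal.coe_ofNat]
  ring

lemma spectralMeasure_add_le (U : unitary (H →L[ℂ] H)) (φ ψ : H) (E : Set UnitCircle) :
    spectralMeasure U (φ + ψ) E ≤ 2 * spectralMeasure U φ E + 2 * spectralMeasure U ψ E := by
  have h := congrArg (fun ν : Measure UnitCircle => ν E) (spectralMeasure_parallelogram U φ ψ)
  simp only [Measure.add_apply, Measure.smul_apply, ENNReal.smul_def, smul_eq_mul,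
    ENNReal.coe_ofNat] at h
  rw [← h]
  exact le_self_add

/-- A measure `μ` on the circle is `α`-continuous if `μ E = 0` for every set `E` whose
`α`-dimensional Hausdorff measure is zero. -/
def AlphaContinuous (α : ℝ) (μ : Measure UnitCircle) : Prop :=
  ∀ E : Set UnitCircle, Measure.hausdorffMeasure α E = 0 → μ E = 0

/-- The subspace of all vectors whose spectral measure with respect to `U` is `α`-continuous. -/
def acSubspace (U : unitary (H →L[ℂ] H)) (α : ℝ) : Submodule ℂ H where
  carrier := {φ | AlphaContinuous α (spectralMeasure U φ)}
  zero_mem' := fun E _ => by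
    refine measure_mono_null (Set.subset_univ E) ?_
    simp [spectralMeasure_univ]
  add_mem' := fun {φ ψ} hφ hψ E hE => by
    have h := spectralMeasure_add_le U φ ψ E
    rw [hφ E hE, hψ E hE] at h
    simpa using h
  smul_mem' := fun c φ hφ E hE => by
    rw [spectralMeasure_smul, Measure.smul_apply, hφ E hE, smul_zero]

lemma isClosed_acSubspace (U : unitary (H →L[ℂ] H)) (α : ℝ) :
    IsClosed (acSubspace U α : Set H) := by
  refine isClosed_of_closure_subset fun ψ hψ E hE => ?_
  have key : ∀ ε : ℝ, 0 < ε → spectralMeasure U ψ E ≤ 2 * ENNReal.ofReal (ε ^ 2) := by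
    intro ε hε
    obtain ⟨φ, hφ, hd⟩ := Metric.mem_closure_iff.1 hψ ε hε
    have h := spectralMeasure_add_le U φ (ψ - φ) E
    rw [add_sub_cancel, hφ E hE, mul_zero, zero_add] at h
    refine h.trans ?_
    gcongr
    refine (measure_mono (Set.subset_univ E)).trans ?_
    rw [spectralMeasure_univ]
    rw [dist_eq_norm] at hd
    gcongr
  have hlim : Tendsto (fun ε : ℝ => 2 * ENNReal.ofReal (ε ^ 2)) (nhdsWithin 0 (Set.Ioi 0))
      (nhds (2 * ENNReal.ofReal ((0 : ℝ) ^ 2))) := by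
    refine Tendsto.mono_left (Continuous.tendsto ?_ 0) nhdsWithin_le_nhds
    exact (ENNReal.continuous_const_mul (by simp)).comp
      (ENNReal.continuous_ofReal.comp (continuous_pow 2))
  have := ge_of_tendsto hlim (eventually_mem_nhdsWithin.mono fun ε hε => key ε hε)
  simpa using this

instance (U : unitary (H →L[ℂ] H)) (α : ℝ) : (acSubspace U α).HasOrthogonalProjection :=
  haveI : CompleteSpace (acSubspace U α) := (isClosed_acSubspace U α).completeSpace_coe
  inferInstance

/-- The orthogonal projection onto the subspace of vectors with `α`-continuous spectral measure. -/
def acProjection (U : unitary (H →L[ℂ] H)) (α : ℝ) : H →L[ℂ] H :=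
  (acSubspace U α).starProjection

end SpectralMeasure

/-- The upper Hausdorff dimension of a measure on the circle: the infimum of the Hausdorff
dimensions of the measurable sets of full measure. -/
def upperHausdorffDim (μ : Measure UnitCircle) : ℝ≥0∞ :=
  ⨅ (S : Set UnitCircle) (_ : MeasurableSet S) (_ : μ S = μ Set.univ), dimH S

section Transport

variable {H : Type*} [NormedAddCommGroup H] [InnerProductSpace ℂ H] [CompleteSpace H]
variable {d : ℕ} {A : Set (Fin d → ℤ)}

/-- The `ℓ¹` norm `|n| = |n₁| + ⋯ + |n_d|`. -/
def l1norm (n : Fin d → ℤ) : ℝ := ∑ i, |(n i : ℝ)|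

/-- `a_ψ(n, k) = |⟨φ_n, U^k ψ⟩|²`. -/
def prob (U : unitary (H →L[ℂ] H)) (ψ : H) (φ : HilbertBasis A ℂ H) (n : A) (k : ℕ) : ℝ :=
  ‖⟪φ n, ((U : H →L[ℂ] H) ^ k) ψ⟫_ℂ‖ ^ 2

/-- The moment `|X|^p_ψ(k) = ∑ₙ (|n|^p + 1) a_ψ(n, k)` of the position operator, a series of
nonnegative terms whose sum may be infinite. -/
def moment (U : unitary (H →L[ℂ] H)) (ψ : H) (φ : HilbertBasis A ℂ H) (p : ℝ) (k : ℕ) : ℝ≥0∞ :=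
  ∑' n : A, ENNReal.ofReal ((l1norm (n : Fin d → ℤ) ^ p + 1) * prob U ψ φ n k)

/-- The Cesàro time-averaged moment `⟨|X|^p_ψ⟩(K) = K⁻¹ ∑_{k < K} |X|^p_ψ(k)`. -/
def avgMoment (U : unitary (H →L[ℂ] H)) (ψ : H) (φ : HilbertBasis A ℂ H) (p : ℝ) (K : ℕ) :
    ℝ≥0∞ :=
  (∑ k ∈ Finset.range K, moment U ψ φ p k) / (K : ℝ≥0∞)

/-- The lower time-averaged transport exponent
`liminf_{K → ∞} log (⟨|X|^p_ψ⟩(K)) / (p log K)`, an extended real number; here `log ∞ = ∞`. -/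
def lowerTransportExponent (U : unitary (H →L[ℂ] H)) (ψ : H) (φ : HilbertBasis A ℂ H) (p : ℝ) :
    EReal :=
  liminf (fun K : ℕ => ENNReal.log (avgMoment U ψ φ p K) / ((p * Real.log K : ℝ) : EReal)) atTop

end Transport

end

end UnitaryTransport

open UnitaryTransport

/-!
This is the Guarneri–Last lower bound for the spreading of a quantum walk. Let `μ` be the spectral
measure of `ψ`, and call a point `α`-Hölder if `μ (closedBall x r) ≤ C r ^ α` for all `r`. The
`α`-Hölder points with constant `C` form a closed set `S = growthSet μ α C`.

*From Hölder points to transport.* Suppose `m = μ S > 0`. The component `η = χ_S(U) ψ` has the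
`α`-Hölder spectral measure `μ|_S` (`exists_spectralProjection`). By Schur's test with the Fejér
kernel (`sum_norm_sq_fourier_le`) and duality, the averaged transition probabilities
`K⁻¹ ∑_{k < K} |⟨φ, U^k η⟩|²` are `O (K ^ (-α))`, uniformly in unit vectors `φ`
(`sum_norm_sq_inner_pow_le`). There are `O (R ^ d)` basis vectors with `|n| ≤ R`, so for `R` a small
multiple of `K ^ (α / d)` most of `η`, hence probability at least `m / 4` of `ψ`, lies on average
outside the ball of radius `R` (`le_avgMoment_of_card_le`). The averaged moment is thus
at least a constant times `K ^ (p α / d)`, which is the bound `α / d` on the exponent.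

*Existence of Hölder points.* By Vitali's covering lemma the points that are `α`-Hölder for no `C`
form an `H^α`-null set (`hausdorffMeasure_compl_iUnion_growthSet`). If `α` is less than the upper
Hausdorff dimension of `μ`, this null set cannot carry `μ`. If the `α`-continuous component `P ψ`
of `ψ` does not vanish, its spectral measure does not charge the null set; if `μ` were carried by
the null set, then `P ψ` and `ψ` would be orthogonal
(`inner_eq_zero_of_spectralMeasure_iUnion`), whereas `⟨P ψ, ψ⟩ = ‖P ψ‖²`.
-/

namespace UnitaryTransport

open Metric Set Topology

/-! ### Points of bounded upper `α`-density -/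

section Density

variable {X : Type*} [MetricSpace X] [MeasurableSpace X]

/-- The points `x` at which `μ` is `α`-Hölder with constant `C`, at all scales: closed balls of
radius `r` around `x` have measure at most `C r ^ α`. -/
def growthSet (μ : Measure X) (α C : ℝ) : Set X :=
  {x | ∀ r : ℝ, 0 < r → μ (closedBall x r) ≤ ENNReal.ofReal (C * r ^ α)}

lemma isClosed_growthSet (μ : Measure X) (α C : ℝ) : IsClosed (growthSet μ α C) := by
  refine isClosed_of_closure_subset fun x hx r hr => ?_
  have key : ∀ ε : ℝ, 0 < ε → μ (closedBall x r) ≤ ENNReal.ofReal (C * (r + ε) ^ α) := by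
    intro ε hε
    obtain ⟨y, hy, hd⟩ := Metric.mem_closure_iff.1 hx ε hε
    refine (measure_mono (closedBall_subset_closedBall' ?_)).trans (hy (r + ε) (by positivity))
    gcongr
  have hlim : Tendsto (fun ε : ℝ => ENNReal.ofReal (C * (r + ε) ^ α)) (𝓝[>] 0)
      (𝓝 (ENNReal.ofReal (C * (r + 0) ^ α))) := by
    refine Tendsto.mono_left ?_ nhdsWithin_le_nhds
    refine ENNReal.tendsto_ofReal (Tendsto.const_mul C ?_)
    exact (tendsto_const_nhds.add tendsto_id).rpow_const (Or.inl (by simpa using hr.ne'))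
  simpa using ge_of_tendsto hlim (eventually_mem_nhdsWithin.mono fun ε hε => key ε hε)

lemma monotone_growthSet (μ : Measure X) (α : ℝ) :
    Monotone fun N : ℕ => growthSet μ α N := by
  intro m n hmn x hx r hr
  refine (hx r hr).trans ?_
  gcongr

/-- The exceptional points, where the upper `α`-density of `μ` is infinite, are negligible for the
`α`-dimensional Hausdorff measure. Vitali's covering lemma extracts from the balls with
`μ (closedBall x r) > N r ^ α` a disjoint family whose enlargements cover; the sum of
their diameters to the power `α` is `O (μ univ / N)`. -/
theorem hausdorffMeasure_compl_iUnion_growthSet [BorelSpace X] (μ : Measure X) [IsFiniteMeasure μ]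
    {α : ℝ} (hα : 0 < α) :
    Measure.hausdorffMeasure α (⋃ N : ℕ, growthSet μ α N)ᶜ = 0 := by
  set T : Set X := (⋃ N : ℕ, growthSet μ α N)ᶜ with hT
  have hT' : ∀ (n : ℕ) (x : X), ∃ r : ℝ, 0 < r ∧
      (x ∈ T → ENNReal.ofReal (((n + 1 : ℕ) : ℝ) * r ^ α) < μ (closedBall x r)) := by
    intro n x
    by_cases hx : x ∈ T
    · simp only [hT, mem_compl_iff, mem_iUnion, not_exists] at hx
      have := hx (n + 1)
      simp only [growthSet, mem_ofPred_eq, not_forall, not_le] at this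
      obtain ⟨r, hr, h⟩ := this
      exact ⟨r, hr, fun _ => h⟩
    · exact ⟨1, one_pos, fun h => absurd h hx⟩
  choose r hr0 hr using hT'
  set M : ℝ := μ.real univ with hM
  set R : ℕ → ℝ := fun n => (M / ((n + 1 : ℕ) : ℝ)) ^ α⁻¹ with hR
  have hrR : ∀ n, ∀ x ∈ T, r n x ≤ R n := by
    intro n x hx
    have h1 := (hr n x hx).trans_le (measure_mono (subset_univ _))
    rw [← ofReal_measureReal (μ := μ) (s := univ), ENNReal.ofReal_lt_ofReal_iff'] at h1
    have hn : (0 : ℝ) < ((n + 1 : ℕ) : ℝ) := by positivity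
    have h2 : r n x ^ α ≤ M / ((n + 1 : ℕ) : ℝ) := by
      rw [le_div_iff₀ hn, mul_comm]; exact h1.1.le
    calc r n x = (r n x ^ α) ^ α⁻¹ := (Real.rpow_rpow_inv (hr0 n x).le hα.ne').symm
      _ ≤ _ := Real.rpow_le_rpow (Real.rpow_nonneg (hr0 n x).le _) h2 (by positivity)
  have hV := fun n => Vitali.exists_disjoint_subfamily_covering_enlargement_closedBall
    T id (r n) (R n) (hrR n) 5 (by norm_num)
  choose u huT hud hcov using hV
  have hpos : ∀ n (x : u n), 0 < μ (closedBall (x : X) (r n x)) := fun n x =>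
    (zero_le).trans_lt (hr n x (huT n x.2))
  have hcount : ∀ n, Countable (u n) := by
    intro n
    have h := Measure.countable_meas_pos_of_disjoint_iUnion (μ := μ)
      (As := fun x : u n => closedBall (x : X) (r n x)) (fun x => isClosed_closedBall.measurableSet)
      (fun x y hxy => hud n x.2 y.2 (fun h => hxy (Subtype.ext h)))
    have h2 : {x : u n | 0 < μ (closedBall (x : X) (r n x))} = univ :=
      eq_univ_of_forall (hpos n)
    rw [h2] at h
    exact countable_univ_iff.1 h
  have hdiam : ∀ n (x : u n), ediam (closedBall (x : X) (5 * r n x))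
      ≤ ENNReal.ofReal (10 * r n x) := by
    intro n x
    refine Metric.ediam_le_of_forall_dist_le fun a ha b hb => ?_
    have := dist_triangle_right a b (x : X)
    rw [mem_closedBall] at ha hb
    linarith
  have hlim : Tendsto (fun n : ℕ => M / ((n + 1 : ℕ) : ℝ)) atTop (𝓝 0) :=
    (tendsto_const_div_atTop_nhds_zero_nat M).comp (tendsto_add_atTop_nat 1)
  have hRlim : Tendsto (fun n => ENNReal.ofReal (10 * R n)) atTop (𝓝 0) := by
    have h := (hlim.rpow_const (p := α⁻¹) (Or.inr (by positivity))).const_mul 10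
    rw [Real.zero_rpow (by positivity), mul_zero] at h
    simpa only [ENNReal.ofReal_zero] using ENNReal.tendsto_ofReal h
  have main := Measure.hausdorffMeasure_le_liminf_tsum α T (l := atTop)
    (fun n => ENNReal.ofReal (10 * R n)) hRlim
    (fun n (x : u n) => closedBall (x : X) (5 * r n x))
    (Eventually.of_forall fun n x => (hdiam n x).trans (by
      gcongr
      exact hrR n x (huT n x.2)))
    (Eventually.of_forall fun n x hx => by
      obtain ⟨b, hb, hsub⟩ := hcov n x hx
      exact mem_iUnion.2 ⟨⟨b, hb⟩, hsub (mem_closedBall_self (hr0 n x).le)⟩)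
  have hsum : ∀ n, ∑' x : u n, ediam (closedBall (x : X) (5 * r n x)) ^ α
      ≤ ENNReal.ofReal (10 ^ α * (M / ((n + 1 : ℕ) : ℝ))) := by
    intro n
    have hn : (0 : ℝ) < ((n + 1 : ℕ) : ℝ) := by positivity
    calc ∑' x : u n, ediam (closedBall (x : X) (5 * r n x)) ^ α
        ≤ ∑' x : u n, ENNReal.ofReal (10 ^ α / ((n + 1 : ℕ) : ℝ))
            * μ (closedBall (x : X) (r n x)) := by
          refine ENNReal.tsum_le_tsum fun x => ?_
          have hx := (hr0 n x).le
          calc ediam (closedBall (x : X) (5 * r n x)) ^ α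
              ≤ ENNReal.ofReal (10 * r n x) ^ α := by
                gcongr
                exact hdiam n x
            _ = ENNReal.ofReal (10 ^ α / ((n + 1 : ℕ) : ℝ))
                  * ENNReal.ofReal (((n + 1 : ℕ) : ℝ) * r n x ^ α) := by
                rw [ENNReal.ofReal_rpow_of_nonneg (by positivity) hα.le,
                  ← ENNReal.ofReal_mul (by positivity), Real.mul_rpow (by norm_num) hx]
                congr 1
                field_simp
            _ ≤ _ := by
                gcongr
                exact (hr n x (huT n x.2)).le
      _ = ENNReal.ofReal (10 ^ α / ((n + 1 : ℕ) : ℝ))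
            * ∑' x : u n, μ (closedBall (x : X) (r n x)) := ENNReal.tsum_mul_left
      _ ≤ ENNReal.ofReal (10 ^ α / ((n + 1 : ℕ) : ℝ)) * μ univ := by
          gcongr
          rw [← measure_iUnion (f := fun x : u n => closedBall (x : X) (r n x))
            (fun x y hxy => hud n x.2 y.2 (fun h => hxy (Subtype.ext h)))
            (fun x => isClosed_closedBall.measurableSet)]
          exact measure_mono (subset_univ _)
      _ = _ := by
          rw [← ofReal_measureReal (μ := μ) (s := univ), ← ENNReal.ofReal_mul (by positivity)]
          congr 1
          ring
  have hzero : Tendsto (fun n : ℕ => ENNReal.ofReal (10 ^ α * (M / ((n + 1 : ℕ) : ℝ)))) atTop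
      (𝓝 0) := by
    have h := hlim.const_mul ((10 : ℝ) ^ α)
    rw [mul_zero] at h
    simpa using ENNReal.tendsto_ofReal h
  refine le_antisymm (main.trans ?_) (zero_le)
  rw [← hzero.liminf_eq]
  exact liminf_le_liminf (Eventually.of_forall hsum)

end Density

/-! ### Spectral projections of closed sets -/

section SpectralProjection

variable {H : Type*} [NormedAddCommGroup H] [InnerProductSpace ℂ H] [CompleteSpace H]

lemma inner_funCalc_toComplex (U : unitary (H →L[ℂ] H)) (ψ : H) (f : UnitCircle → ℝ)
    (hf : Continuous f) :
    ⟪ψ, funCalc U (toComplex f hf) ψ⟫_ℂ = ((∫ z, f z ∂(spectralMeasure U ψ) : ℝ) : ℂ) := by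
  apply Complex.ext
  · rw [integral_spectralMeasure_real U ψ f hf, Complex.ofReal_re]
  · rw [inner_funCalc_im, Complex.ofReal_im]

lemma inner_funCalc_left (U : unitary (H →L[ℂ] H)) (φ ψ : H) (f : C(UnitCircle, ℂ)) :
    ⟪funCalc U f φ, ψ⟫_ℂ = ⟪φ, funCalc U (star f) ψ⟫_ℂ := by
  rw [map_star, ContinuousLinearMap.star_eq_adjoint, ContinuousLinearMap.adjoint_inner_right]

lemma star_toComplex (f : UnitCircle → ℝ) (hf : Continuous f) :
    star (toComplex f hf) = toComplex f hf := by
  ext z; simp [toComplex]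

lemma norm_funCalc_sq (U : unitary (H →L[ℂ] H)) (ψ : H) (f : C(UnitCircle, ℂ)) :
    ‖funCalc U f ψ‖ ^ 2 = ∫ z, ‖f z‖ ^ 2 ∂(spectralMeasure U ψ) := by
  have h1 : star f * f = toComplex (fun z => ‖f z‖ ^ 2) (by fun_prop) := by
    ext z
    simp [toComplex, Complex.conj_mul']
  rw [integral_spectralMeasure_real U ψ _ (by fun_prop), ← h1, map_mul, mul_apply_eq_comp,
    ← inner_funCalc_left, ← inner_self_eq_norm_sq (𝕜 := ℂ)]
  rfl

lemma norm_sq_eq_spectralMeasure (U : unitary (H →L[ℂ] H)) (ψ : H) :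
    ‖ψ‖ ^ 2 = (spectralMeasure U ψ).real univ := by
  rw [measureReal_def, spectralMeasure_univ, ENNReal.toReal_ofReal (by positivity)]

/-- The indicator function of a closed set is a pointwise limit of continuous functions
`0 ≤ f n ≤ 1`. -/
lemma exists_continuous_tendsto_indicator {X : Type*} [PseudoMetricSpace X] {S : Set X}
    (hS : IsClosed S) :
    ∃ f : ℕ → X → ℝ, (∀ n, Continuous (f n)) ∧ (∀ n x, 0 ≤ f n x) ∧ (∀ n x, f n x ≤ 1) ∧
      ∀ x, Tendsto (fun n => f n x) atTop (𝓝 (S.indicator (fun _ => (1 : ℝ)) x)) := by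
  have hδ : ∀ n : ℕ, (0 : ℝ) < 1 / ((n : ℝ) + 1) := fun n => Nat.one_div_pos_of_nat
  refine ⟨fun n x => (thickenedIndicator (hδ n) S x : ℝ), fun n => by fun_prop,
    fun n x => NNReal.coe_nonneg _, fun n x => thickenedIndicator_le_one (hδ n) S x, fun x => ?_⟩
  have h := thickenedIndicator_tendsto_indicator_closure hδ
    tendsto_one_div_add_atTop_nhds_zero_nat S
  rw [hS.closure_eq, tendsto_pi_nhds] at h
  have h2 := (NNReal.continuous_coe.tendsto _).comp (h x)
  refine h2.congr' (Eventually.of_forall fun n => rfl) |>.trans_eq ?_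
  by_cases hx : x ∈ S <;> simp [hx]

/-- The spectral projection `χ_S(U)` of a closed set `S`, with the properties that the argument
uses: it is symmetric, and the spectral measure of `χ_S(U) ψ` is that of `ψ` restricted to `S`. It
is the strong limit of `f n (U)` for continuous `0 ≤ f n ≤ 1` converging pointwise to `χ_S`. -/
theorem exists_spectralProjection (U : unitary (H →L[ℂ] H)) {S : Set UnitCircle}
    (hS : IsClosed S) :
    ∃ E : H → H, (∀ φ ψ, ⟪E φ, ψ⟫_ℂ = ⟪φ, E ψ⟫_ℂ) ∧
      (∀ ψ, spectralMeasure U (E ψ) = (spectralMeasure U ψ).restrict S) ∧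
      ∀ ψ, ⟪E ψ, ψ⟫_ℂ = ((spectralMeasure U ψ).real S : ℂ) := by
  obtain ⟨f, hfc, hf0, hf1, hlim⟩ := exists_continuous_tendsto_indicator hS
  have habs : ∀ n x, |f n x| ≤ 1 := fun n x => by rw [abs_of_nonneg (hf0 n x)]; exact hf1 n x
  set F : ℕ → C(UnitCircle, ℂ) := fun n => toComplex (f n) (hfc n) with hF
  have hconv : ∀ ψ, ∃ v, Tendsto (fun n => funCalc U (F n) ψ) atTop (𝓝 v) := by
    intro ψ
    set μ := spectralMeasure U ψ with hμ
    set χ : UnitCircle → ℝ := S.indicator (fun _ => (1 : ℝ)) with hχ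
    have hχm : Measurable χ := measurable_const.indicator hS.measurableSet
    have hχb : ∀ x, |χ x| ≤ 1 := fun x => by
      by_cases hx : x ∈ S <;> simp [hχ, hx]
    have hb : ∀ n x, ‖(f n x - χ x) ^ 2‖ ≤ 4 := fun n x => by
      rw [Real.norm_eq_abs, abs_of_nonneg (sq_nonneg _)]
      have h1 := abs_le.1 (habs n x)
      have h2 := abs_le.1 (hχb x)
      nlinarith
    have hint : ∀ n, Integrable (fun z => (f n z - χ z) ^ 2) μ := fun n =>
      Integrable.of_bound (((hfc n).measurable.sub hχm).pow_const 2).aestronglyMeasurable 4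
        (Eventually.of_forall (hb n))
    have he : Tendsto (fun n => ∫ z, (f n z - χ z) ^ 2 ∂μ) atTop (𝓝 0) := by
      have h := tendsto_integral_of_dominated_convergence (μ := μ)
        (F := fun n z => (f n z - χ z) ^ 2) (f := fun _ => (0 : ℝ)) (fun _ => (4 : ℝ))
        (fun n => (hint n).aestronglyMeasurable) (integrable_const _)
        (fun n => Eventually.of_forall (hb n))
        (Eventually.of_forall fun z => by
          have h := ((hlim z).sub_const (χ z)).pow 2
          simpa [hχ] using h)
      simpa using h
    have hdist : ∀ m n, ‖funCalc U (F m) ψ - funCalc U (F n) ψ‖ ^ 2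
        ≤ 2 * ∫ z, (f m z - χ z) ^ 2 ∂μ + 2 * ∫ z, (f n z - χ z) ^ 2 ∂μ := by
      intro m n
      rw [← sub_apply, ← map_sub, norm_funCalc_sq, ← integral_const_mul, ← integral_const_mul,
        ← integral_add ((hint m).const_mul 2) ((hint n).const_mul 2)]
      refine integral_mono_of_nonneg (Eventually.of_forall fun z => sq_nonneg _)
        (((hint m).const_mul 2).add ((hint n).const_mul 2)) (Eventually.of_forall fun z => ?_)
      simp only [hF, toComplex, ContinuousMap.sub_apply, ContinuousMap.coe_mk,
        ← Complex.ofReal_sub, Complex.norm_real, Real.norm_eq_abs, sq_abs]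
      nlinarith [sq_nonneg (f m z - χ z + (f n z - χ z))]
    refine cauchySeq_tendsto_of_complete (Metric.cauchySeq_iff.2 fun ε hε => ?_)
    obtain ⟨N, hN⟩ := eventually_atTop.1 (he.eventually (gt_mem_nhds (show (0 : ℝ) < ε ^ 2 / 4 by
      positivity)))
    refine ⟨N, fun m hm n hn => ?_⟩
    rw [dist_eq_norm]
    refine lt_of_pow_lt_pow_left₀ 2 hε.le ?_
    have := hdist m n
    have := hN m hm
    have := hN n hn
    linarith
  choose E hE using hconv
  refine ⟨E, fun φ ψ => ?_, fun ψ => ?_, fun ψ => ?_⟩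
  · have h1 := (hE φ).inner (𝕜 := ℂ) (tendsto_const_nhds (x := ψ))
    have h2 := (tendsto_const_nhds (x := φ)).inner (𝕜 := ℂ) (hE ψ)
    refine tendsto_nhds_unique h1 (h2.congr fun n => ?_)
    rw [inner_funCalc_left, hF, star_toComplex]
  · symm
    refine eq_spectralMeasure U (E ψ) _ fun g hg => ?_
    set G : C(UnitCircle, ℂ) := toComplex g hg with hG
    have h1 : Tendsto (fun n => (⟪funCalc U (F n) ψ, funCalc U G (funCalc U (F n) ψ)⟫_ℂ).re) atTop
        (𝓝 (⟪E ψ, funCalc U G (E ψ)⟫_ℂ).re) :=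
      (Complex.continuous_re.tendsto _).comp
        ((hE ψ).inner (((funCalc U G).continuous.tendsto _).comp (hE ψ)))
    obtain ⟨C, hC⟩ := isCompact_univ.exists_bound_of_continuousOn hg.continuousOn
    have h2 : Tendsto (fun n => ∫ z, f n z * (g z * f n z) ∂(spectralMeasure U ψ)) atTop
        (𝓝 (∫ z, S.indicator g z ∂(spectralMeasure U ψ))) := by
      refine tendsto_integral_of_dominated_convergence (fun _ => C)
        (fun n => ((hfc n).mul (hg.mul (hfc n))).aestronglyMeasurable) (integrable_const _)
        (fun n => Eventually.of_forall fun z => ?_) (Eventually.of_forall fun z => ?_)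
      · rw [norm_mul, norm_mul, Real.norm_eq_abs (f n z)]
        calc |f n z| * (‖g z‖ * |f n z|) ≤ 1 * (‖g z‖ * 1) := by
              gcongr
              · exact habs n z
              · exact habs n z
          _ = ‖g z‖ := by ring
          _ ≤ C := hC z (mem_univ z)
      · have h := (hlim z).mul ((hlim z).const_mul (g z))
        by_cases hz : z ∈ S <;> simpa [hz] using h
    rw [← integral_indicator hS.measurableSet]
    refine tendsto_nhds_unique h2 (h1.congr fun n => ?_)
    have h3 : star (F n) * (G * F n)
        = toComplex (fun z => f n z * (g z * f n z)) ((hfc n).mul (hg.mul (hfc n))) := by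
      ext z; simp [hF, hG, toComplex]
    rw [integral_spectralMeasure_real U ψ (fun z => f n z * (g z * f n z))
      ((hfc n).mul (hg.mul (hfc n))), ← h3, map_mul, map_mul, inner_funCalc_left]
    rfl
  · have h1 := (hE ψ).inner (𝕜 := ℂ) (tendsto_const_nhds (x := ψ))
    have h2 : Tendsto (fun n => ∫ z, f n z ∂(spectralMeasure U ψ)) atTop
        (𝓝 (∫ z, S.indicator (fun _ => (1 : ℝ)) z ∂(spectralMeasure U ψ))) :=
      tendsto_integral_of_dominated_convergence (fun _ => (1 : ℝ))
        (fun n => (hfc n).aestronglyMeasurable) (integrable_const _)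
        (fun n => Eventually.of_forall fun z => habs n z) (Eventually.of_forall hlim)
    rw [integral_indicator_const _ hS.measurableSet, smul_eq_mul, mul_one] at h2
    refine tendsto_nhds_unique h1 (((Complex.continuous_ofReal.tendsto _).comp h2).congr
      fun n => ?_)
    rw [inner_funCalc_left, hF, star_toComplex, inner_funCalc_toComplex]
    rfl

end SpectralProjection

/-! ### The Fejér kernel and Fourier coefficients of Hölder measures -/

section FejerKernel

open ComplexConjugate

/-- The (unnormalised) Fejér kernel `|∑_{j < N} (z w̄) ^ j|²` on the circle. -/
noncomputable def fejerKernel (N : ℕ) (z w : UnitCircle) : ℝ :=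
  ‖∑ j ∈ Finset.range N, ((z : ℂ) * conj (w : ℂ)) ^ j‖ ^ 2

lemma norm_unitCircle (z : UnitCircle) : ‖(z : ℂ)‖ = 1 := by simp

lemma continuous_fejerKernel (N : ℕ) :
    Continuous fun x : UnitCircle × UnitCircle => fejerKernel N x.1 x.2 := by
  unfold fejerKernel; fun_prop

lemma fejerKernel_nonneg (N : ℕ) (z w : UnitCircle) : 0 ≤ fejerKernel N z w := by
  unfold fejerKernel; positivity

lemma fejerKernel_comm (N : ℕ) (z w : UnitCircle) : fejerKernel N z w = fejerKernel N w z := by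
  unfold fejerKernel
  rw [← Complex.norm_conj (∑ j ∈ Finset.range N, ((w : ℂ) * conj (z : ℂ)) ^ j)]
  simp [mul_comm]

lemma fejerKernel_le_sq (N : ℕ) (z w : UnitCircle) : fejerKernel N z w ≤ (N : ℝ) ^ 2 := by
  unfold fejerKernel
  gcongr
  refine (norm_sum_le _ _).trans ?_
  simp

lemma fejerKernel_mul_dist_sq_le (N : ℕ) (z w : UnitCircle) :
    fejerKernel N z w * dist z w ^ 2 ≤ 4 := by
  have h1 : dist z w = ‖(z : ℂ) * conj (w : ℂ) - 1‖ := by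
    have hw : (w : ℂ) * conj (w : ℂ) = 1 := by
      rw [Complex.mul_conj']; simp
    rw [Subtype.dist_eq, dist_eq_norm, ← hw, ← sub_mul, norm_mul, Complex.norm_conj,
      norm_unitCircle, mul_one]
  unfold fejerKernel
  rw [h1, ← mul_pow, ← norm_mul, geom_sum_mul]
  have h2 : ‖((z : ℂ) * conj (w : ℂ)) ^ N - 1‖ ≤ 2 := by
    refine (norm_sub_le _ _).trans ?_
    rw [norm_pow, norm_mul, Complex.norm_conj, norm_unitCircle, norm_unitCircle]
    norm_num
  calc _ ≤ (2 : ℝ) ^ 2 := by gcongr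
    _ = 4 := by norm_num

/-- The layer-cake formula, and the fact that `fejerKernel N z w > t` forces `t < N ^ 2` and
`dist z w ≤ 2 / √t`. -/
lemma integral_fejerKernel_le (ν : Measure UnitCircle) [IsFiniteMeasure ν] {α C : ℝ}
    (hα : α < 2) (hC : 0 ≤ C) (N : ℕ) {z : UnitCircle} (hz : z ∈ growthSet ν α C) :
    ∫ w, fejerKernel N z w ∂ν ≤ C * 2 ^ α * ((N : ℝ) ^ (2 - α) / (1 - α / 2)) := by
  have hcont : Continuous fun w => fejerKernel N z w := by
    unfold fejerKernel; fun_prop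
  have hα' : (0 : ℝ) < 1 - α / 2 := by linarith
  have hnn : 0 ≤ᵐ[ν] fun w => fejerKernel N z w :=
    Eventually.of_forall fun w => fejerKernel_nonneg N z w
  rw [integral_eq_lintegral_of_nonneg_ae hnn hcont.aestronglyMeasurable,
    lintegral_eq_lintegral_meas_lt ν hnn hcont.aemeasurable]
  refine ENNReal.toReal_le_of_le_ofReal (by positivity) ?_
  have hpt : ∀ t ∈ Ioi (0 : ℝ), ν {w | t < fejerKernel N z w}
      ≤ (Ioc (0 : ℝ) ((N : ℝ) ^ 2)).indicator
        (fun t => ENNReal.ofReal (C * 2 ^ α * t ^ (-(α / 2)))) t := by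
    intro t ht
    rw [mem_Ioi] at ht
    by_cases htN : t ≤ (N : ℝ) ^ 2
    · rw [indicator_of_mem (show t ∈ Ioc (0 : ℝ) ((N : ℝ) ^ 2) from ⟨ht, htN⟩)]
      have hr : (0 : ℝ) < 2 / √t := by positivity
      have hsub : {w | t < fejerKernel N z w} ⊆ closedBall z (2 / √t) := by
        intro w hw
        rw [mem_ofPred_eq] at hw
        rw [mem_closedBall, dist_comm, le_div_iff₀ (by positivity)]
        refine le_of_sq_le_sq ?_ (by norm_num)
        rw [mul_pow, Real.sq_sqrt ht.le]
        calc dist z w ^ 2 * t ≤ dist z w ^ 2 * fejerKernel N z w := by gcongr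
          _ ≤ 2 ^ 2 := by
            rw [mul_comm]; exact (fejerKernel_mul_dist_sq_le N z w).trans (by norm_num)
      refine (measure_mono hsub).trans ((hz _ hr).trans_eq ?_)
      congr 1
      rw [mul_assoc, Real.div_rpow (by norm_num) (by positivity), Real.sqrt_eq_rpow,
        ← Real.rpow_mul ht.le, Real.rpow_neg ht.le, div_eq_mul_inv]
      ring_nf
    · have : {w | t < fejerKernel N z w} = ∅ := by
        refine eq_empty_of_forall_notMem fun w hw => ?_
        exact htN ((le_of_lt hw).trans (fejerKernel_le_sq N z w))
      rw [this, measure_empty]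
      exact zero_le
  refine (setLIntegral_mono' measurableSet_Ioi hpt).trans ?_
  rw [setLIntegral_indicator measurableSet_Ioc,
    inter_eq_left.2 (fun t ht => ht.1)]
  have hN : (0 : ℝ) ≤ (N : ℝ) ^ 2 := by positivity
  have hint : IntervalIntegrable (fun t : ℝ => C * 2 ^ α * t ^ (-(α / 2))) volume 0
      ((N : ℝ) ^ 2) := (intervalIntegral.intervalIntegrable_rpow' (by linarith)).const_mul _
  rw [← ofReal_integral_eq_lintegral_ofReal ((intervalIntegrable_iff_integrableOn_Ioc_of_le hN).1
    hint) (ae_restrict_of_forall_mem measurableSet_Ioc fun t ht => by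
      have := ht.1; positivity)]
  rw [← intervalIntegral.integral_of_le hN, intervalIntegral.integral_const_mul,
    integral_rpow (Or.inl (by linarith)), Real.zero_rpow (by linarith), sub_zero]
  have e1 : -(α / 2) + 1 = 1 - α / 2 := by ring
  have e2 : ((2 : ℕ) : ℝ) * (1 - α / 2) = 2 - α := by push_cast; ring
  rw [e1, ← Real.rpow_natCast, ← Real.rpow_mul (by positivity), e2]

/-- Schur's test with the kernel `fejerKernel N`: the double sum on the left is
`∬ g(z) ḡ(w) fejerKernel N z w`. -/
lemma sum_norm_sq_fourier_le_of_fejerKernel (ν : Measure UnitCircle) [IsFiniteMeasure ν] {B : ℝ}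
    (N : ℕ) (hB : ∀ᵐ z ∂ν, ∫ w, fejerKernel N z w ∂ν ≤ B) (g : C(UnitCircle, ℂ)) :
    ∑ l ∈ Finset.range N, ∑ j ∈ Finset.range N,
      ‖∫ z, (z : ℂ) ^ j * conj (z : ℂ) ^ l * g z ∂ν‖ ^ 2 ≤ B * ∫ z, ‖g z‖ ^ 2 ∂ν := by
  have hi : ∀ {E : Type} [NormedAddCommGroup E] {f : UnitCircle × UnitCircle → E},
      Continuous f → Integrable f (ν.prod ν) := fun hf =>
    hf.integrable_of_hasCompactSupport (HasCompactSupport.of_compactSpace _)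
  have hi1 : ∀ {f : UnitCircle → ℝ}, Continuous f → Integrable f ν := fun hf =>
    hf.integrable_of_hasCompactSupport (HasCompactSupport.of_compactSpace _)
  set e : ℕ → ℕ → UnitCircle → ℂ := fun l j z => (z : ℂ) ^ j * conj (z : ℂ) ^ l * g z with he
  have hec : ∀ l j, Continuous (e l j) := fun l j => by simp only [he]; fun_prop
  set W : UnitCircle × UnitCircle → ℝ :=
    fun x => 2⁻¹ * (‖g x.1‖ ^ 2 * fejerKernel N x.1 x.2)
      + 2⁻¹ * (‖g x.2‖ ^ 2 * fejerKernel N x.1 x.2) with hW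
  have hfc := continuous_fejerKernel N
  have hc1 : Continuous fun x : UnitCircle × UnitCircle =>
      ‖g x.1‖ ^ 2 * fejerKernel N x.1 x.2 := by fun_prop
  have hc2 : Continuous fun x : UnitCircle × UnitCircle =>
      ‖g x.2‖ ^ 2 * fejerKernel N x.1 x.2 := by fun_prop
  have hpw : ∀ x : UnitCircle × UnitCircle,
      ∑ l ∈ Finset.range N, ∑ j ∈ Finset.range N, e l j x.1 * conj (e l j x.2)
        = g x.1 * conj (g x.2) * (fejerKernel N x.1 x.2 : ℂ) := by
    intro x
    have h1 : (fejerKernel N x.1 x.2 : ℂ)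
        = (∑ j ∈ Finset.range N, ((x.1 : ℂ) * conj (x.2 : ℂ)) ^ j)
          * ∑ l ∈ Finset.range N, (conj (x.1 : ℂ) * (x.2 : ℂ)) ^ l := by
      rw [fejerKernel, Complex.ofReal_pow, ← Complex.mul_conj']
      simp
    rw [h1, Finset.sum_mul_sum, Finset.mul_sum, Finset.sum_comm]
    refine Finset.sum_congr rfl fun j _ => ?_
    rw [Finset.mul_sum]
    refine Finset.sum_congr rfl fun l _ => ?_
    simp only [he, map_mul, map_pow, Complex.conj_conj]
    ring
  have hkey : ((∑ l ∈ Finset.range N, ∑ j ∈ Finset.range N, ‖∫ z, e l j z ∂ν‖ ^ 2 : ℝ) : ℂ)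
      = ∫ x, g x.1 * conj (g x.2) * (fejerKernel N x.1 x.2 : ℂ) ∂(ν.prod ν) := by
    simp_rw [← hpw]
    rw [integral_finsetSum _ fun l _ => hi (by fun_prop)]
    push_cast
    refine Finset.sum_congr rfl fun l _ => ?_
    rw [integral_finsetSum _ fun j _ => hi (by fun_prop)]
    refine Finset.sum_congr rfl fun j _ => ?_
    rw [integral_prod_mul (fun z => e l j z) (fun w => conj (e l j w)), integral_conj,
      Complex.mul_conj']
  have h1 : ∫ x, ‖g x.1‖ ^ 2 * fejerKernel N x.1 x.2 ∂(ν.prod ν) ≤ B * ∫ z, ‖g z‖ ^ 2 ∂ν := by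
    rw [integral_prod _ (hi hc1), ← integral_const_mul]
    refine integral_mono_ae (hi hc1).integral_prod_left (hi1 (by fun_prop)) ?_
    filter_upwards [hB] with z hz
    simp only [integral_const_mul]
    rw [mul_comm]
    gcongr
  have h2 : ∫ x, ‖g x.2‖ ^ 2 * fejerKernel N x.1 x.2 ∂(ν.prod ν) ≤ B * ∫ z, ‖g z‖ ^ 2 ∂ν := by
    rw [← integral_prod_swap]
    simpa only [Prod.fst_swap, Prod.snd_swap, fejerKernel_comm N] using h1
  calc ∑ l ∈ Finset.range N, ∑ j ∈ Finset.range N, ‖∫ z, e l j z ∂ν‖ ^ 2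
      = ‖((∑ l ∈ Finset.range N, ∑ j ∈ Finset.range N, ‖∫ z, e l j z ∂ν‖ ^ 2 : ℝ) : ℂ)‖ := by
        rw [Complex.norm_real, Real.norm_of_nonneg (by positivity)]
    _ ≤ ∫ x, W x ∂(ν.prod ν) := by
        rw [hkey]
        refine norm_integral_le_of_norm_le (hi (by fun_prop)) (Eventually.of_forall fun x => ?_)
        rw [norm_mul, norm_mul, Complex.norm_conj, Complex.norm_real,
          Real.norm_of_nonneg (fejerKernel_nonneg _ _ _)]
        have h3 := two_mul_le_add_sq ‖g x.1‖ ‖g x.2‖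
        have h4 := fejerKernel_nonneg N x.1 x.2
        simp only [hW]
        nlinarith
    _ = 2⁻¹ * ∫ x, ‖g x.1‖ ^ 2 * fejerKernel N x.1 x.2 ∂(ν.prod ν)
        + 2⁻¹ * ∫ x, ‖g x.2‖ ^ 2 * fejerKernel N x.1 x.2 ∂(ν.prod ν) := by
        rw [← integral_const_mul, ← integral_const_mul,
          ← integral_add ((hi hc1).const_mul _) ((hi hc2).const_mul _)]
    _ ≤ _ := by linarith

/-- A Strichartz-type estimate: the average of the first `K` Fourier coefficients squared of
`g ν`, for an `α`-Hölder measure `ν`, is `O (K ^ (-α))`. -/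
theorem sum_norm_sq_fourier_le (ν : Measure UnitCircle) [IsFiniteMeasure ν] {α C : ℝ}
    (hα : α < 2) (hC : 0 ≤ C) (hν : ∀ᵐ z ∂ν, z ∈ growthSet ν α C) {K : ℕ} (hK : 0 < K)
    (g : C(UnitCircle, ℂ)) :
    ∑ k ∈ Finset.range K, ‖∫ z, (z : ℂ) ^ k * g z ∂ν‖ ^ 2
      ≤ 8 * C / (2 - α) * (K : ℝ) ^ (1 - α) * ∫ z, ‖g z‖ ^ 2 ∂ν := by
  have h := sum_norm_sq_fourier_le_of_fejerKernel ν (2 * K)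
    (hν.mono fun z hz => integral_fejerKernel_le ν hα hC (2 * K) hz) g
  have hK' : (0 : ℝ) < K := by exact_mod_cast hK
  -- every difference `0 ≤ k < K` occurs at least `K` times as `j - l` with `j, l < 2 K`
  have h1 : (K : ℝ) * ∑ k ∈ Finset.range K, ‖∫ z, (z : ℂ) ^ k * g z ∂ν‖ ^ 2
      ≤ ∑ l ∈ Finset.range (2 * K), ∑ j ∈ Finset.range (2 * K),
        ‖∫ z, (z : ℂ) ^ j * conj (z : ℂ) ^ l * g z ∂ν‖ ^ 2 := by
    rw [← nsmul_eq_mul, ← Finset.card_range K, ← Finset.sum_const, Finset.card_range]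
    refine (Finset.sum_le_sum fun l hl => ?_).trans (Finset.sum_le_sum_of_subset_of_nonneg
      (Finset.range_mono (show K ≤ 2 * K by omega)) fun _ _ _ => by positivity)
    have h2 : ∀ k, ∫ z, (z : ℂ) ^ k * g z ∂ν
        = ∫ z, (z : ℂ) ^ (l + k) * conj (z : ℂ) ^ l * g z ∂ν := by
      intro k
      congr 1
      ext z
      have hz : (z : ℂ) * conj (z : ℂ) = 1 := by
        rw [Complex.mul_conj']; simp
      rw [pow_add, mul_right_comm ((z : ℂ) ^ l), ← mul_pow, hz, one_pow, one_mul]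
    simp_rw [h2]
    have h3 := Finset.sum_Ico_eq_sum_range
      (fun j => ‖∫ z, (z : ℂ) ^ j * conj (z : ℂ) ^ l * g z ∂ν‖ ^ 2) l (l + K)
    rw [Nat.add_sub_cancel_left] at h3
    rw [← h3]
    refine Finset.sum_le_sum_of_subset_of_nonneg (fun j hj => ?_) fun _ _ _ => by positivity
    rw [Finset.mem_Ico] at hj
    rw [Finset.mem_range] at hl ⊢
    omega
  have h4 := h1.trans h
  have h5 : C * 2 ^ α * (((2 * K : ℕ) : ℝ) ^ (2 - α) / (1 - α / 2))
      = K * (8 * C / (2 - α) * (K : ℝ) ^ (1 - α)) := by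
    have e1 : (2 : ℝ) ^ α * 2 ^ (2 - α) = 4 := by
      rw [← Real.rpow_add (by norm_num), add_sub_cancel]; norm_num
    have e2 : (K : ℝ) ^ (2 - α) = K * (K : ℝ) ^ (1 - α) := by
      rw [← Real.rpow_one_add' hK'.le (by linarith)]; ring_nf
    have e3 : (2 : ℝ) - α ≠ 0 := by linarith
    have e4 : (1 : ℝ) - α / 2 = (2 - α) / 2 := by ring
    push_cast
    rw [Real.mul_rpow (by norm_num) hK'.le, e2, e4]
    calc _ = C * (2 ^ α * 2 ^ (2 - α)) * (K * (K : ℝ) ^ (1 - α)) * 2 / (2 - α) := by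
          field_simp
      _ = _ := by rw [e1]; ring
  rw [h5, mul_assoc (K : ℝ)] at h4
  exact le_of_mul_le_mul_left h4 hK'

end FejerKernel

/-! ### Decay of averaged transition probabilities -/

section Decay

open ComplexConjugate

variable {H : Type*} [NormedAddCommGroup H] [InnerProductSpace ℂ H] [CompleteSpace H]

/-- If the spectral measure of `η` is `α`-Hölder, the averaged transition probability from `η`
to any vector `φ` decays like `K ^ (-α)`. By duality this is an estimate of `‖P(U) η‖`, that is,
of the norm of `P` in `L²` of the spectral measure, for polynomials `P` of degree less than
`K`. -/
theorem sum_norm_sq_inner_pow_le (U : unitary (H →L[ℂ] H)) (η φ : H) {α C : ℝ}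
    (hα : α < 2) (hC : 0 ≤ C)
    (hη : ∀ᵐ z ∂(spectralMeasure U η), z ∈ growthSet (spectralMeasure U η) α C)
    {K : ℕ} (hK : 0 < K) :
    ∑ k ∈ Finset.range K, ‖⟪φ, ((U : H →L[ℂ] H) ^ k) η⟫_ℂ‖ ^ 2
      ≤ 8 * C / (2 - α) * (K : ℝ) ^ (1 - α) * ‖φ‖ ^ 2 := by
  set ν := spectralMeasure U η with hν
  set D : ℝ := 8 * C / (2 - α) * (K : ℝ) ^ (1 - α) with hD
  have hD0 : 0 ≤ D := by
    have : 0 < 2 - α := by linarith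
    positivity
  set c : ℕ → ℂ := fun k => ⟪φ, ((U : H →L[ℂ] H) ^ k) η⟫_ℂ with hc
  set s : ℝ := ∑ k ∈ Finset.range K, ‖c k‖ ^ 2 with hs
  set P : C(UnitCircle, ℂ) :=
    ∑ k ∈ Finset.range K, conj (c k) • (⟨fun z => (z : ℂ), continuous_subtype_val⟩ :
      C(UnitCircle, ℂ)) ^ k with hP
  have hPz : ∀ z, P z = ∑ k ∈ Finset.range K, conj (c k) * (z : ℂ) ^ k := by
    intro z
    simp [hP]
  have hPU : funCalc U P η = ∑ k ∈ Finset.range K, conj (c k) • ((U : H →L[ℂ] H) ^ k) η := by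
    simp only [hP, map_sum, map_smul, map_pow, funCalc_id, sum_apply,
      smul_apply]
  set q : ℝ := ∫ z, ‖P z‖ ^ 2 ∂ν with hq
  have hnorm : ‖funCalc U P η‖ ^ 2 = q := norm_funCalc_sq U η P
  have hs0 : 0 ≤ s := by positivity
  have hq0 : 0 ≤ q := hnorm ▸ sq_nonneg _
  have hsq : s ^ 2 ≤ ‖φ‖ ^ 2 * q := by
    have h1 : ⟪φ, funCalc U P η⟫_ℂ = (s : ℂ) := by
      rw [hPU, inner_sum, hs, Complex.ofReal_sum]
      refine Finset.sum_congr rfl fun k _ => ?_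
      rw [inner_smul_right, Complex.conj_mul', Complex.ofReal_pow]
    have h2 := norm_inner_le_norm (𝕜 := ℂ) φ (funCalc U P η)
    rw [h1, Complex.norm_real, Real.norm_of_nonneg hs0] at h2
    rw [← hnorm, ← mul_pow]
    gcongr
  have hqs : q ^ 2 ≤ s * (D * q) := by
    have hstar : ∀ z, (star P) z = conj (P z) := fun z => rfl
    have h1 : (q : ℂ) = ∑ k ∈ Finset.range K, conj (c k) * ∫ z, (z : ℂ) ^ k * (star P) z ∂ν := by
      simp_rw [← integral_const_mul]
      have hi : ∀ k ∈ Finset.range K,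
          Integrable (fun z : UnitCircle => conj (c k) * ((z : ℂ) ^ k * (star P) z)) ν :=
        fun k _ => Continuous.integrable_of_hasCompactSupport (by fun_prop)
          (HasCompactSupport.of_compactSpace _)
      rw [← integral_finsetSum _ hi, hq, ← integral_complex_ofReal]
      congr 1
      ext z
      simp_rw [← mul_assoc]
      rw [← Finset.sum_mul, ← hPz, hstar, Complex.mul_conj']
      push_cast
      rfl
    have h2 : q ≤ ∑ k ∈ Finset.range K, ‖c k‖ * ‖∫ z, (z : ℂ) ^ k * (star P) z ∂ν‖ := by
      calc q = ‖(q : ℂ)‖ := by rw [Complex.norm_real, Real.norm_of_nonneg hq0]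
        _ ≤ _ := by
          rw [h1]
          refine (norm_sum_le _ _).trans_eq (Finset.sum_congr rfl fun k _ => ?_)
          rw [norm_mul, Complex.norm_conj]
    have h3 := sum_norm_sq_fourier_le ν hα hC hη hK (star P)
    simp_rw [hstar, Complex.norm_conj] at h3
    calc q ^ 2 ≤ (∑ k ∈ Finset.range K, ‖c k‖ * ‖∫ z, (z : ℂ) ^ k * (star P) z ∂ν‖) ^ 2 := by
          gcongr
      _ ≤ s * ∑ k ∈ Finset.range K, ‖∫ z, (z : ℂ) ^ k * (star P) z ∂ν‖ ^ 2 :=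
          Finset.sum_mul_sq_le_sq_mul_sq _ _ _
      _ ≤ s * (D * q) := by
          gcongr
          exact h3
  rcases hs0.eq_or_lt with h | h
  · rw [← h]; positivity
  · have hq1 : q ≤ s * D := by
      rcases hq0.eq_or_lt with h' | h'
      · rw [← h']; positivity
      · nlinarith
    have h5 : s * s ≤ s * (D * ‖φ‖ ^ 2) := by nlinarith [sq_nonneg ‖φ‖]
    exact le_of_mul_le_mul_left h5 h

end Decay

/-! ### Lower bounds for the moments -/

/-- The vector `w` is split into its components inside and outside of the finite set `F` of basis
vectors. -/
lemma norm_sq_inner_le_of_orthonormal {H : Type*} [NormedAddCommGroup H]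
    [InnerProductSpace ℂ H] {ι : Type*} {φ : ι → H} (hφ : Orthonormal ℂ φ)
    (F : Finset ι) (v w : H) :
    ‖⟪v, w⟫_ℂ‖ ^ 2 ≤ 2 * (‖w‖ ^ 2 * ∑ n ∈ F, ‖⟪φ n, v⟫_ℂ‖ ^ 2
      + ‖v‖ ^ 2 * (‖w‖ ^ 2 - ∑ n ∈ F, ‖⟪φ n, w⟫_ℂ‖ ^ 2)) := by
  set w' : H := ∑ n ∈ F, ⟪φ n, w⟫_ℂ • φ n with hw'
  have h1 : ‖⟪v, w'⟫_ℂ‖ ^ 2 ≤ ‖w‖ ^ 2 * ∑ n ∈ F, ‖⟪φ n, v⟫_ℂ‖ ^ 2 := by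
    have h2 : ‖⟪v, w'⟫_ℂ‖ ≤ ∑ n ∈ F, ‖⟪φ n, w⟫_ℂ‖ * ‖⟪φ n, v⟫_ℂ‖ := by
      rw [hw', inner_sum]
      refine (norm_sum_le _ _).trans_eq (Finset.sum_congr rfl fun n _ => ?_)
      rw [inner_smul_right, norm_mul, norm_inner_symm v]
    calc ‖⟪v, w'⟫_ℂ‖ ^ 2 ≤ (∑ n ∈ F, ‖⟪φ n, w⟫_ℂ‖ * ‖⟪φ n, v⟫_ℂ‖) ^ 2 := by gcongr
      _ ≤ (∑ n ∈ F, ‖⟪φ n, w⟫_ℂ‖ ^ 2) * ∑ n ∈ F, ‖⟪φ n, v⟫_ℂ‖ ^ 2 :=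
        Finset.sum_mul_sq_le_sq_mul_sq _ _ _
      _ ≤ _ := by
        gcongr
        exact hφ.sum_inner_products_le w
  have h3 : ‖w - w'‖ ^ 2 = ‖w‖ ^ 2 - ∑ n ∈ F, ‖⟪φ n, w⟫_ℂ‖ ^ 2 := by
    have e1 : ⟪w, w'⟫_ℂ = ((∑ n ∈ F, ‖⟪φ n, w⟫_ℂ‖ ^ 2 : ℝ) : ℂ) := by
      rw [hw', inner_sum]
      push_cast
      refine Finset.sum_congr rfl fun n _ => ?_
      rw [inner_smul_right, ← inner_conj_symm w, Complex.mul_conj']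
    have e2 : ⟪w', w'⟫_ℂ = ((∑ n ∈ F, ‖⟪φ n, w⟫_ℂ‖ ^ 2 : ℝ) : ℂ) := by
      rw [hw', hφ.inner_sum]
      push_cast
      exact Finset.sum_congr rfl fun n _ => Complex.conj_mul' _
    have e3 : ‖w'‖ ^ 2 = ∑ n ∈ F, ‖⟪φ n, w⟫_ℂ‖ ^ 2 := by
      rw [← inner_self_eq_norm_sq (𝕜 := ℂ), e2]; exact Complex.ofReal_re _
    have e4 : RCLike.re ⟪w, w'⟫_ℂ = ∑ n ∈ F, ‖⟪φ n, w⟫_ℂ‖ ^ 2 := by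
      rw [e1]; exact Complex.ofReal_re _
    rw [norm_sub_sq (𝕜 := ℂ), e3, e4]
    ring
  have h4 : ‖⟪v, w - w'⟫_ℂ‖ ^ 2 ≤ ‖v‖ ^ 2 * ‖w - w'‖ ^ 2 := by
    rw [← mul_pow]
    gcongr
    exact norm_inner_le_norm _ _
  have h5 : ‖⟪v, w⟫_ℂ‖ ≤ ‖⟪v, w'⟫_ℂ‖ + ‖⟪v, w - w'⟫_ℂ‖ := by
    rw [inner_sub_right]
    simpa using norm_add_le ⟪v, w'⟫_ℂ (⟪v, w⟫_ℂ - ⟪v, w'⟫_ℂ)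
  rw [← h3]
  calc ‖⟪v, w⟫_ℂ‖ ^ 2 ≤ (‖⟪v, w'⟫_ℂ‖ + ‖⟪v, w - w'⟫_ℂ‖) ^ 2 := by gcongr
    _ ≤ 2 * (‖⟪v, w'⟫_ℂ‖ ^ 2 + ‖⟪v, w - w'⟫_ℂ‖ ^ 2) := add_sq_le
    _ ≤ _ := by gcongr

section Moments

variable {H : Type*} [NormedAddCommGroup H] [InnerProductSpace ℂ H] [CompleteSpace H]
variable {d : ℕ} {A : Set (Fin d → ℤ)}

lemma inner_pow_apply_pow_apply (U : unitary (H →L[ℂ] H)) (k : ℕ) (v w : H) :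
    ⟪((U : H →L[ℂ] H) ^ k) v, ((U : H →L[ℂ] H) ^ k) w⟫_ℂ = ⟪v, w⟫_ℂ :=
  ContinuousLinearMap.inner_map_map_of_mem_unitary (U ^ k).2 v w

lemma norm_pow_apply (U : unitary (H →L[ℂ] H)) (k : ℕ) (v : H) :
    ‖((U : H →L[ℂ] H) ^ k) v‖ = ‖v‖ :=
  ContinuousLinearMap.norm_map_of_mem_unitary (U ^ k).2 v

lemma hasSum_prob (U : unitary (H →L[ℂ] H)) (ψ : H) (φ : HilbertBasis A ℂ H) (k : ℕ) :
    HasSum (fun n => prob U ψ φ n k) (‖ψ‖ ^ 2) := by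
  have h := (φ.hasSum_inner_mul_inner (((U : H →L[ℂ] H) ^ k) ψ)
    (((U : H →L[ℂ] H) ^ k) ψ)).mapL Complex.reCLM
  have h1 : Complex.reCLM ⟪((U : H →L[ℂ] H) ^ k) ψ, ((U : H →L[ℂ] H) ^ k) ψ⟫_ℂ = ‖ψ‖ ^ 2 := by
    rw [inner_pow_apply_pow_apply]
    exact inner_self_eq_norm_sq (𝕜 := ℂ) ψ
  rw [h1] at h
  refine h.congr_fun fun n => ?_
  simp only [prob]
  rw [← inner_conj_symm _ (φ n), Complex.conj_mul', Complex.reCLM_apply, ← Complex.ofReal_pow,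
    Complex.ofReal_re]

/-- The lattice points of `ℓ¹` norm at most `R` lie in a box with at most `(3 R) ^ d` points. -/
lemma exists_finset_l1norm (A : Set (Fin d → ℤ)) {R : ℝ} (hR : 1 ≤ R) :
    ∃ F : Finset A, (F.card : ℝ) ≤ (3 * R) ^ d ∧
      ∀ n : A, n ∉ F → R ≤ l1norm (n : Fin d → ℤ) := by
  classical
  set box : Finset (Fin d → ℤ) := Fintype.piFinset fun _ => Finset.Icc (-⌊R⌋) ⌊R⌋ with hbox
  refine ⟨box.subtype (· ∈ A), ?_, fun n hn => ?_⟩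
  · have h1 : (box.subtype (· ∈ A)).card ≤ box.card := by
      rw [Finset.card_subtype]
      exact Finset.card_filter_le _ _
    have h0 : 0 ≤ ⌊R⌋ := Int.floor_nonneg.2 (by linarith)
    have h2 : (box.card : ℝ) = (2 * (⌊R⌋ : ℝ) + 1) ^ d := by
      rw [hbox, Fintype.card_piFinset]
      simp only [Int.card_Icc, Finset.prod_const, Finset.card_univ, Fintype.card_fin]
      push_cast
      congr 1
      have : ((⌊R⌋ + 1 - -⌊R⌋).toNat : ℤ) = 2 * ⌊R⌋ + 1 := by
        rw [Int.toNat_of_nonneg (by omega)]; ring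
      exact_mod_cast this
    calc ((box.subtype (· ∈ A)).card : ℝ) ≤ box.card := by exact_mod_cast h1
      _ = (2 * (⌊R⌋ : ℝ) + 1) ^ d := h2
      _ ≤ (3 * R) ^ d := by
        have h3 := Int.floor_le R
        have h4 : (0 : ℝ) ≤ ⌊R⌋ := by exact_mod_cast h0
        gcongr
        linarith
  · rw [Finset.mem_subtype, hbox, Fintype.mem_piFinset] at hn
    push Not at hn
    obtain ⟨i, hi⟩ := hn
    rw [Finset.mem_Icc, ← abs_le, not_le, Int.floor_lt] at hi
    push_cast at hi
    exact hi.le.trans (Finset.single_le_sum (f := fun i => |((n : Fin d → ℤ) i : ℝ)|)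
      (fun i _ => abs_nonneg _) (Finset.mem_univ i))

lemma le_moment (U : unitary (H →L[ℂ] H)) (ψ : H) (φ : HilbertBasis A ℂ H) {p R : ℝ}
    (hp : 0 < p) (hR : 0 ≤ R) (F : Finset A)
    (hF : ∀ n : A, n ∉ F → R ≤ l1norm (n : Fin d → ℤ)) (k : ℕ) :
    ENNReal.ofReal (R ^ p * (‖ψ‖ ^ 2 - ∑ n ∈ F, prob U ψ φ n k)) ≤ moment U ψ φ p k := by
  classical
  have hprob : ∀ n, 0 ≤ prob U ψ φ n k := fun n => sq_nonneg _
  have h1 : HasSum (fun n => if n ∈ F then prob U ψ φ n k else 0) (∑ n ∈ F, prob U ψ φ n k) := by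
    have h : HasSum (fun n => if n ∈ F then prob U ψ φ n k else 0)
        (∑ n ∈ F, if n ∈ F then prob U ψ φ n k else 0) :=
      hasSum_sum_of_ne_finset_zero (fun n hn => by simp [hn])
    rwa [Finset.sum_congr rfl fun n hn => if_pos hn] at h
  have h2 := ((hasSum_prob U ψ φ k).sub h1).mul_left (R ^ p)
  rw [← h2.tsum_eq, ENNReal.ofReal_tsum_of_nonneg (fun n => ?_) h2.summable]
  · refine ENNReal.tsum_le_tsum fun n => ENNReal.ofReal_le_ofReal ?_
    have hl : 0 ≤ l1norm (n : Fin d → ℤ) := Finset.sum_nonneg fun i _ => abs_nonneg _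
    by_cases hn : n ∈ F
    · simp only [hn, if_true, sub_self, mul_zero]
      have := hprob n
      positivity
    · simp only [hn, if_false, sub_zero]
      refine mul_le_mul_of_nonneg_right ?_ (hprob n)
      have := Real.rpow_le_rpow hR (hF n hn) hp.le
      linarith
  · have := hprob n
    by_cases hn : n ∈ F <;> simp only [hn, if_true, if_false, sub_self, sub_zero, mul_zero, le_refl]
    positivity

end Moments

/-! ### The transport bound -/

section TransportBound

variable {H : Type*} [NormedAddCommGroup H] [InnerProductSpace ℂ H] [CompleteSpace H]
variable {d : ℕ} {A : Set (Fin d → ℤ)}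

/-- If the decay estimate for the component `η = χ_S(U) ψ`, where `S` is the set of `α`-Hölder
points and `m = ‖η‖²`, keeps the averaged probability of `η` in the finite set `F` below
`m² / 4`, then `ψ` has averaged probability at least `m / 4` outside of `F`. -/
lemma le_avgMoment_of_card_le (U : unitary (H →L[ℂ] H)) {ψ : H} (hψ : ‖ψ‖ = 1)
    (φ : HilbertBasis A ℂ H) {p α C R : ℝ} (hp : 0 < p) (hα : α < 2) (hC : 0 ≤ C) (hR : 0 ≤ R)
    (hm : 0 < (spectralMeasure U ψ).real (growthSet (spectralMeasure U ψ) α C))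
    (F : Finset A) (hF : ∀ n : A, n ∉ F → R ≤ l1norm (n : Fin d → ℤ)) {K : ℕ} (hK : 0 < K)
    (hcard : F.card * (8 * C / (2 - α) * (K : ℝ) ^ (1 - α))
      ≤ K * ((spectralMeasure U ψ).real (growthSet (spectralMeasure U ψ) α C) ^ 2 / 4)) :
    ENNReal.ofReal
        (R ^ p * ((spectralMeasure U ψ).real (growthSet (spectralMeasure U ψ) α C) / 4))
      ≤ avgMoment U ψ φ p K := by
  set μ := spectralMeasure U ψ with hμ
  set S := growthSet μ α C with hS
  set m := μ.real S with hm'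
  have hSc : IsClosed S := isClosed_growthSet μ α C
  obtain ⟨E, -, hE, hEψ⟩ := exists_spectralProjection U hSc
  set η := E ψ with hη
  have hην : spectralMeasure U η = μ.restrict S := hE ψ
  have hηm : ‖η‖ ^ 2 = m := by
    rw [norm_sq_eq_spectralMeasure U, hην, measureReal_restrict_apply_univ]
  have hgrowth : ∀ᵐ z ∂(spectralMeasure U η), z ∈ growthSet (spectralMeasure U η) α C := by
    rw [hην]
    filter_upwards [ae_restrict_mem hSc.measurableSet] with z hz r hr
    exact (Measure.restrict_apply_le _ _).trans (hz r hr)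
  set x : ℕ → ℝ := fun k => ‖ψ‖ ^ 2 - ∑ n ∈ F, prob U ψ φ n k with hx
  set y : ℕ → ℝ := fun k => ∑ n ∈ F, ‖⟪φ n, ((U : H →L[ℂ] H) ^ k) η⟫_ℂ‖ ^ 2 with hy
  have hx0 : ∀ k, 0 ≤ x k := fun k => by
    have h := φ.orthonormal.sum_inner_products_le (s := F) (((U : H →L[ℂ] H) ^ k) ψ)
    rw [norm_pow_apply] at h
    exact sub_nonneg.2 h
  have hxy : ∀ k, m ^ 2 ≤ 2 * (y k + m * x k) := by
    intro k
    have h := norm_sq_inner_le_of_orthonormal φ.orthonormal F (((U : H →L[ℂ] H) ^ k) η)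
      (((U : H →L[ℂ] H) ^ k) ψ)
    rw [inner_pow_apply_pow_apply, norm_pow_apply, norm_pow_apply, hηm, hEψ ψ,
      Complex.norm_real, Real.norm_of_nonneg hm.le, hψ, one_pow, one_mul] at h
    simpa only [hx, hy, hψ, one_pow, prob] using h
  have hysum : ∑ k ∈ Finset.range K, y k ≤ K * (m ^ 2 / 4) := by
    rw [Finset.sum_comm]
    refine le_trans ?_ hcard
    rw [← nsmul_eq_mul, ← Finset.sum_const]
    refine Finset.sum_le_sum fun n _ => ?_
    have h := sum_norm_sq_inner_pow_le U η (φ n) hα hC hgrowth hK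
    rwa [φ.orthonormal.1 n, one_pow, mul_one] at h
  have hsum : K * m ^ 2 ≤ 2 * (∑ k ∈ Finset.range K, y k + m * ∑ k ∈ Finset.range K, x k) := by
    have h := Finset.sum_le_sum (s := Finset.range K) fun k _ => hxy k
    rwa [Finset.sum_const, Finset.card_range, nsmul_eq_mul, ← Finset.mul_sum,
      Finset.sum_add_distrib, ← Finset.mul_sum] at h
  have hxsum : K * (m / 4) ≤ ∑ k ∈ Finset.range K, x k := by
    refine le_of_mul_le_mul_left ?_ hm
    nlinarith
  have hK' : (0 : ℝ) < K := by exact_mod_cast hK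
  rw [avgMoment, ENNReal.le_div_iff_mul_le (Or.inl (by exact_mod_cast hK.ne'))
    (Or.inl (ENNReal.natCast_ne_top K)), ← ENNReal.ofReal_natCast,
    ← ENNReal.ofReal_mul (by positivity)]
  calc ENNReal.ofReal (R ^ p * (m / 4) * K)
      ≤ ENNReal.ofReal (∑ k ∈ Finset.range K, R ^ p * x k) := by
        refine ENNReal.ofReal_le_ofReal ?_
        rw [← Finset.mul_sum, mul_assoc, mul_comm (m / 4)]
        gcongr
    _ = ∑ k ∈ Finset.range K, ENNReal.ofReal (R ^ p * x k) :=
        ENNReal.ofReal_sum_of_nonneg fun k _ => mul_nonneg (by positivity) (hx0 k)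
    _ ≤ _ := Finset.sum_le_sum fun k _ => le_moment U ψ φ hp hR F hF k

theorem exists_le_avgMoment (hd : 0 < d) (U : unitary (H →L[ℂ] H)) {ψ : H} (hψ : ‖ψ‖ = 1)
    (φ : HilbertBasis A ℂ H) {p α C : ℝ} (hp : 0 < p) (hα0 : 0 < α) (hα : α < 2) (hC : 0 ≤ C)
    (hm : spectralMeasure U ψ (growthSet (spectralMeasure U ψ) α C) ≠ 0) :
    ∃ c : ℝ, 0 < c ∧ ∀ᶠ K : ℕ in atTop,
      ENNReal.ofReal (c * (K : ℝ) ^ (p * (α / d))) ≤ avgMoment U ψ φ p K := by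
  have hm' : 0 < (spectralMeasure U ψ).real (growthSet (spectralMeasure U ψ) α C) :=
    measureReal_nonneg.lt_of_ne' ((measureReal_ne_zero_iff).2 hm)
  have hd' : (0 : ℝ) < d := by exact_mod_cast hd
  set m := (spectralMeasure U ψ).real (growthSet (spectralMeasure U ψ) α C) with hmdef
  set D : ℝ := 8 * C / (2 - α) with hD
  have hD0 : 0 ≤ D := by
    have : 0 < 2 - α := by linarith
    positivity
  -- the radius `R = b K ^ (α / d)` is chosen such that `(3 R) ^ d (D + 1) K ^ (-α) = m² / 4`
  set b : ℝ := (m ^ 2 / (4 * (D + 1))) ^ (d : ℝ)⁻¹ / 3 with hb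
  have hb0 : 0 < b := by positivity
  refine ⟨b ^ p * (m / 4), by positivity, ?_⟩
  have hlarge : ∀ᶠ K : ℕ in atTop, 1 ≤ b * (K : ℝ) ^ (α / d) := by
    have h := ((tendsto_rpow_atTop (show 0 < α / d by positivity)).comp
      (tendsto_natCast_atTop_atTop (R := ℝ))).const_mul_atTop hb0
    exact h.eventually_ge_atTop 1
  filter_upwards [hlarge, eventually_gt_atTop 0] with K hK hK0
  have hK' : (0 : ℝ) < K := by exact_mod_cast hK0
  obtain ⟨F, hcard, hF⟩ := exists_finset_l1norm A hK
  have h3 : (3 * (b * (K : ℝ) ^ (α / d))) ^ d = m ^ 2 / (4 * (D + 1)) * (K : ℝ) ^ α := by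
    have e : 3 * (b * (K : ℝ) ^ (α / d))
        = (m ^ 2 / (4 * (D + 1))) ^ (d : ℝ)⁻¹ * (K : ℝ) ^ (α / d) := by rw [hb]; ring
    rw [e, mul_pow, Real.rpow_inv_natCast_pow (by positivity) hd.ne',
      ← Real.rpow_natCast ((K : ℝ) ^ (α / d)), ← Real.rpow_mul hK'.le, div_mul_cancel₀ _ hd'.ne']
  have h := le_avgMoment_of_card_le U hψ φ hp hα hC (by linarith) hm' F hF hK0 ?_
  · refine le_trans (le_of_eq ?_) h
    congr 1
    rw [Real.mul_rpow hb0.le (by positivity), ← Real.rpow_mul hK'.le, mul_comm p]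
    ring
  · calc F.card * (D * (K : ℝ) ^ (1 - α))
        ≤ m ^ 2 / (4 * (D + 1)) * (K : ℝ) ^ α * ((D + 1) * (K : ℝ) ^ (1 - α)) := by
          rw [h3] at hcard
          gcongr
          linarith
      _ = m ^ 2 / 4 * ((K : ℝ) ^ α * (K : ℝ) ^ (1 - α)) := by field_simp
      _ = K * (m ^ 2 / 4) := by
          rw [← Real.rpow_add hK', add_sub_cancel, Real.rpow_one]; ring

lemma le_lowerTransportExponent_of_eventually (U : unitary (H →L[ℂ] H)) (ψ : H)
    (φ : HilbertBasis A ℂ H) {p s c : ℝ} (hp : 0 < p) (hc : 0 < c)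
    (h : ∀ᶠ K : ℕ in atTop, ENNReal.ofReal (c * (K : ℝ) ^ (p * s)) ≤ avgMoment U ψ φ p K) :
    (s : EReal) ≤ lowerTransportExponent U ψ φ p := by
  refine le_of_forall_lt fun a ha => ?_
  obtain ⟨t, hat, hts⟩ := EReal.lt_iff_exists_real_btwn.1 ha
  refine hat.trans_le ?_
  have hts' : 0 < p * (s - t) := mul_pos hp (sub_pos.2 (EReal.coe_lt_coe_iff.1 hts))
  -- the constant `c` is absorbed by lowering the exponent from `s` to `t`
  have hsmall : ∀ᶠ K : ℕ in atTop, (K : ℝ) ^ (-(p * (s - t))) < c :=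
    ((tendsto_rpow_neg_atTop hts').comp (tendsto_natCast_atTop_atTop (R := ℝ))).eventually
      (gt_mem_nhds hc)
  refine le_liminf_of_le (by isBoundedDefault) ?_
  filter_upwards [h, hsmall, eventually_gt_atTop 1] with K hK hKc hK1
  have hK1' : (1 : ℝ) < K := by exact_mod_cast hK1
  have hK0 : (0 : ℝ) < K := by linarith
  have hlog : 0 < p * Real.log K := mul_pos hp (Real.log_pos hK1')
  rw [EReal.le_div_iff_mul_le (by exact_mod_cast hlog) (EReal.coe_ne_top _)]
  have h1 : (K : ℝ) ^ (p * t) ≤ c * (K : ℝ) ^ (p * s) := by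
    calc (K : ℝ) ^ (p * t) = (K : ℝ) ^ (-(p * (s - t))) * (K : ℝ) ^ (p * s) := by
          rw [← Real.rpow_add hK0]; ring_nf
      _ ≤ _ := by gcongr
  have h2 := ENNReal.log_le_log ((ENNReal.ofReal_le_ofReal h1).trans hK)
  rw [ENNReal.log_ofReal_of_pos (by positivity), Real.log_rpow hK0] at h2
  refine le_trans (le_of_eq ?_) h2
  rw [← EReal.coe_mul]
  congr 1
  ring

lemma one_le_avgMoment (U : unitary (H →L[ℂ] H)) {ψ : H} (hψ : ‖ψ‖ = 1)
    (φ : HilbertBasis A ℂ H) (p : ℝ) {K : ℕ} (hK : 0 < K) : 1 ≤ avgMoment U ψ φ p K := by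
  have h1 : ∀ k, 1 ≤ moment U ψ φ p k := by
    intro k
    have h := hasSum_prob U ψ φ k
    calc (1 : ℝ≥0∞) = ENNReal.ofReal (∑' n, prob U ψ φ n k) := by rw [h.tsum_eq, hψ]; simp
      _ = ∑' n, ENNReal.ofReal (prob U ψ φ n k) :=
          ENNReal.ofReal_tsum_of_nonneg (fun n => sq_nonneg _) h.summable
      _ ≤ _ := ENNReal.tsum_le_tsum fun n => ENNReal.ofReal_le_ofReal <|
          le_mul_of_one_le_left (sq_nonneg _) (le_add_of_nonneg_left
            (Real.rpow_nonneg (Finset.sum_nonneg fun i _ => abs_nonneg _) _))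
  rw [avgMoment, ENNReal.le_div_iff_mul_le (Or.inl (by exact_mod_cast hK.ne'))
    (Or.inl (ENNReal.natCast_ne_top K)), one_mul]
  calc (K : ℝ≥0∞) = ∑ k ∈ Finset.range K, 1 := by simp
    _ ≤ _ := Finset.sum_le_sum fun k _ => h1 k

lemma lowerTransportExponent_nonneg (U : unitary (H →L[ℂ] H)) {ψ : H} (hψ : ‖ψ‖ = 1)
    (φ : HilbertBasis A ℂ H) {p : ℝ} (hp : 0 < p) : 0 ≤ lowerTransportExponent U ψ φ p := by
  refine le_lowerTransportExponent_of_eventually U ψ φ (s := 0) hp one_pos ?_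
  filter_upwards [eventually_gt_atTop 0] with K hK
  simpa using one_le_avgMoment U hψ φ p hK

/-- The transport bound holds as soon as `ψ` has some spectral weight on the points of bounded
upper `α`-density. -/
theorem div_le_lowerTransportExponent (hd : 0 < d) (U : unitary (H →L[ℂ] H)) {ψ : H}
    (hψ : ‖ψ‖ = 1) (φ : HilbertBasis A ℂ H) {p α : ℝ} (hp : 0 < p) (hα0 : 0 < α) (hα : α < 2)
    (hμ : spectralMeasure U ψ (⋃ N : ℕ, growthSet (spectralMeasure U ψ) α N) ≠ 0) :
    ((α / (d : ℝ) : ℝ) : EReal) ≤ lowerTransportExponent U ψ φ p := by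
  rw [Ne, measure_iUnion_null_iff, not_forall] at hμ
  obtain ⟨N, hN⟩ := hμ
  obtain ⟨c, hc, h⟩ := exists_le_avgMoment hd U hψ φ hp hα0 hα N.cast_nonneg hN
  exact le_lowerTransportExponent_of_eventually U ψ φ hp hc h

end TransportBound

/-! ### Dimension and the `α`-continuous subspace -/

section Dimension

variable {H : Type*} [NormedAddCommGroup H] [InnerProductSpace ℂ H] [CompleteSpace H]

/-- The circle has dimension one; the bound by the dimension of the plane is all that is needed. -/
lemma upperHausdorffDim_le_two (μ : Measure UnitCircle) : upperHausdorffDim μ ≤ 2 := by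
  refine (iInf₂_le_of_le univ MeasurableSet.univ (iInf_le _ rfl)).trans ?_
  rw [← (isometry_subtype_coe (s := UnitCircle)).dimH_image]
  refine (dimH_mono (subset_univ _)).trans ?_
  rw [Real.dimH_univ_eq_finrank, Complex.finrank_real_complex]
  norm_num

lemma measurableSet_iUnion_growthSet (μ : Measure UnitCircle) (α : ℝ) :
    MeasurableSet (⋃ N : ℕ, growthSet μ α N) :=
  MeasurableSet.iUnion fun _ => (isClosed_growthSet μ α _).measurableSet

lemma measure_iUnion_growthSet_ne_zero (μ : Measure UnitCircle) [IsFiniteMeasure μ] {α : ℝ≥0}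
    (hα : 0 < α) (h : (α : ℝ≥0∞) < upperHausdorffDim μ) :
    μ (⋃ N : ℕ, growthSet μ α N) ≠ 0 := by
  intro h0
  refine h.not_ge ?_
  have hmeas := measurableSet_iUnion_growthSet μ α
  refine (iInf₂_le_of_le _ hmeas.compl (iInf_le _ ?_)).trans
    (dimH_le_of_hausdorffMeasure_ne_top (d := α) ?_)
  · rw [measure_compl hmeas (measure_ne_top _ _), h0, tsub_zero]
  · rw [hausdorffMeasure_compl_iUnion_growthSet μ (by exact_mod_cast hα)]
    exact ENNReal.zero_ne_top

/-- If `μ_ψ` does not charge the increasing union of the closed sets `S N`, and `μ_φ` is carried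
by it, then `φ` and `ψ` are orthogonal: `χ_{S N}(U) φ` tends to `φ` and is orthogonal to `ψ`. -/
lemma inner_eq_zero_of_spectralMeasure_iUnion (U : unitary (H →L[ℂ] H)) {φ ψ : H}
    {S : ℕ → Set UnitCircle} (hS : ∀ N, IsClosed (S N)) (hmono : Monotone S)
    (hφ : spectralMeasure U φ (⋃ N, S N)ᶜ = 0) (hψ : spectralMeasure U ψ (⋃ N, S N) = 0) :
    ⟪φ, ψ⟫_ℂ = 0 := by
  choose E hsymm hE hEself using fun N => exists_spectralProjection U (hS N)
  have hEψ : ∀ N, E N ψ = 0 := fun N => by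
    have h := norm_sq_eq_spectralMeasure U (E N ψ)
    rw [hE, measureReal_restrict_apply_univ, measureReal_def,
      measure_iUnion_null_iff.1 hψ N, ENNReal.toReal_zero] at h
    exact norm_eq_zero.1 (pow_eq_zero_iff two_ne_zero |>.1 h)
  have hzero : ∀ N, ⟪E N φ, ψ⟫_ℂ = 0 := fun N => by rw [hsymm, hEψ, inner_zero_right]
  have hnorm : ∀ N, ‖E N φ - φ‖ ^ 2 = ‖φ‖ ^ 2 - (spectralMeasure U φ).real (S N) := fun N => by
    have h1 := norm_sq_eq_spectralMeasure U (E N φ)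
    rw [hE, measureReal_restrict_apply_univ] at h1
    have h2 : RCLike.re ⟪E N φ, φ⟫_ℂ = (spectralMeasure U φ).real (S N) := by
      rw [hEself]; exact Complex.ofReal_re _
    rw [norm_sub_sq (𝕜 := ℂ), h1, h2]
    ring
  have hfull : spectralMeasure U φ (⋃ N, S N) = spectralMeasure U φ univ := by
    rw [← measure_add_measure_compl (MeasurableSet.iUnion fun N => (hS N).measurableSet), hφ,
      add_zero]
  have hlim : Tendsto (fun N => (spectralMeasure U φ).real (S N)) atTop (𝓝 (‖φ‖ ^ 2)) := by
    have h := tendsto_measure_iUnion_atTop (μ := spectralMeasure U φ) hmono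
    rw [hfull] at h
    rw [norm_sq_eq_spectralMeasure U]
    exact (ENNReal.tendsto_toReal (measure_ne_top _ _)).comp h
  have hEφ : Tendsto (fun N => E N φ) atTop (𝓝 φ) := by
    rw [tendsto_iff_norm_sub_tendsto_zero]
    have h := (hlim.const_sub (‖φ‖ ^ 2)).congr fun N => (hnorm N).symm
    rw [sub_self] at h
    simpa using h.sqrt
  have h := hEφ.inner (𝕜 := ℂ) (tendsto_const_nhds (x := ψ))
  exact tendsto_nhds_unique h (tendsto_const_nhds.congr fun N => (hzero N).symm)

end Dimension

end UnitaryTransport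

theorem corollary3p7
    {H : Type*} [NormedAddCommGroup H] [InnerProductSpace ℂ H] [CompleteSpace H]
    (d : ℕ) (hd : 0 < d)
    (A : Set (Fin d → ℤ))
    (hA : A = Set.univ ∨ A = {n | ∀ i, 0 ≤ n i} ∨ A = {n | ∀ i, 1 ≤ n i})
    (φ : HilbertBasis A ℂ H)
    (U : unitary (H →L[ℂ] H)) (ψ : H) (hψ : ‖ψ‖ = 1)
    (p : ℝ) (hp : 0 < p) :
    ((upperHausdorffDim (spectralMeasure U ψ) / (d : ENNReal) : ENNReal) : EReal)
        ≤ lowerTransportExponent U ψ φ p ∧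
      ∀ α : ℝ, 0 ≤ α → α ≤ 1 → acProjection U α ψ ≠ 0 →
        ((α / (d : ℝ) : ℝ) : EReal) ≤ lowerTransportExponent U ψ φ p := by
  refine ⟨?_, fun α hα0 hα1 hP => ?_⟩
  · have hd' : (d : ℝ≥0∞) ≠ 0 := by exact_mod_cast hd.ne'
    refine le_of_forall_lt fun a ha => ?_
    rcases lt_or_ge a 0 with h0 | h0
    · exact h0.trans_le (lowerTransportExponent_nonneg U hψ φ hp)
    -- a real `t > 0` between `a` and the left-hand side; then `α = t d` is admissible
    obtain ⟨t, hat, ht⟩ := EReal.lt_iff_exists_real_btwn.1 ha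
    have ht0 : 0 < t := EReal.coe_pos.1 (h0.trans_lt hat)
    lift t to ℝ≥0 using ht0.le
    have ht' : (t : ℝ≥0∞) < upperHausdorffDim (spectralMeasure U ψ) / d := by
      rw [← EReal.coe_ennreal_lt_coe_ennreal_iff]
      exact ht
    rw [ENNReal.lt_div_iff_mul_lt (Or.inl hd') (Or.inl (ENNReal.natCast_ne_top d))] at ht'
    have hα : ((t * d : ℝ≥0) : ℝ≥0∞) < upperHausdorffDim (spectralMeasure U ψ) := by
      push_cast; exact ht'
    have hα0 : 0 < t * d := mul_pos (by exact_mod_cast ht0) (by exact_mod_cast hd)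
    have hα2 : t * d < 2 := by
      exact_mod_cast hα.trans_le (upperHausdorffDim_le_two _)
    have h := div_le_lowerTransportExponent hd U hψ φ hp (α := (t * d : ℝ≥0))
      (by exact_mod_cast hα0) (by exact_mod_cast hα2)
      (measure_iUnion_growthSet_ne_zero _ hα0 hα)
    have e : ((t * d : ℝ≥0) : ℝ) / d = t := by
      have : (d : ℝ) ≠ 0 := by exact_mod_cast hd.ne'
      push_cast
      field_simp
    rw [e] at h
    exact hat.trans_le h
  · rcases hα0.eq_or_lt with h0 | h0
    · rw [← h0, zero_div]
      exact lowerTransportExponent_nonneg U hψ φ hp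
    refine div_le_lowerTransportExponent hd U hψ φ hp h0 (by linarith) fun hzero => hP ?_
    have hmem : acProjection U α ψ ∈ acSubspace U α := Submodule.starProjection_apply_mem _ ψ
    have horth : ⟪acProjection U α ψ, ψ⟫_ℂ = 0 :=
      inner_eq_zero_of_spectralMeasure_iUnion U (fun N => isClosed_growthSet _ α _)
        (monotone_growthSet (spectralMeasure U ψ) α)
        (hmem _ (hausdorffMeasure_compl_iUnion_growthSet _ h0)) hzero
    have h := Submodule.re_inner_starProjection_eq_normSq (acSubspace U α) ψ
    rw [show (acSubspace U α).starProjection ψ = acProjection U α ψ from rfl, horth] at h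
    change (acSubspace U α).starProjection ψ = 0
    simpa using h.symm
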